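/- \textbf{Conventions.} For a finite simple graph $G$ let $I(G;x)=\sum_{k=0}^{\alpha(G)} s_k(G)x^k$ be its independence polynomial, where $s_k(G)$ is the number of independent sets of size $k$ and $\alpha(G)$ is the independence number. A polynomial with coefficient sequence $(a_0,\dots,a_d)$ is \emph{unimodal} if for some $m$ one has $a_0\le\dots\le a_m\ge\dots\ge a_d$, and \emph{log-concave} if $a_i^2\ge a_{i-1}a_{i+1}$ for $1\le i\le d-1$. A \emph{one-edge enlargement} of a tree $T$ is a graph $T+uv$, where $u\neq v$ are nonadjacent vertices of $T$; there is one enlargement for each nonedge $\{u,v\}$ (vertices are labelled; isomorphic enlargements are counted separately). Attaching a $P_s$-arm to a vertex $w$ means adding a new path with $s$ vertices and joining one of its end vertices to $w$. The tree $T_{3,m,n}$ has a root $v_0$ with three children $v_1,v_2,v_3$, to which $3$, $m$ and $n$ $P_2$-arms are attached respectively. The tree $T^{*}_{3,m,n}$ is obtained from $T_{3,m,n}$ by replacing one of the three $P_2$-arms at $v_1$ by a $P_4$-arm. \textbf{Theorem.} Consider the seven collections of trees \begin{enumerate} \item $T_{3,k,k}$, $4\le k\le 12$; \item $T_{3,k,k+1}$,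 $4\le k\le 9$; \item $T_{3,k,k+2}$, $4\le k\le 9$; \item $T^{*}_{3,k,k+1}$, $3\le k\le 8$; \item $T^{*}_{3,k-1,k+1}$, $4\le k\le 9$; \item $T^{*}_{3,k,k}$, $4\le k\le 9$; \item $T^{*}_{3,k,k+3}$, $4\le k\le 9$. \end{enumerate} Every one-edge enlargement of every tree in these collections has a unimodal independence polynomial. However, none of the collections enjoys universal preservation of non-log-concavity: each collection contains a tree $T$ such that $I(T;x)$ is not log-concave but $I(T+e;x)$ is log-concave for some nonedge $e$ of $T$. The numbers of one-edge enlargements of the trees in collections (1)--(7) are respectively $7860$, $4136$, $4586$, $3710$, $4136$, $4136$, $5558$, in total $34122$; the numbers of those with log-concave independence polynomial are respectively $2296$, $1306$, $1822$, $1216$, $1394$, $1211$, $3180$, in total $12425$. -/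

import Mathlib

/-! ### Independence polynomials, unimodality, log-concavity -/

/-- The number `s_k(G)` of independent sets of size `k` in `G`. -/
noncomputable def indepCount {V : Type*} (G : SimpleGraph V) (k : ℕ) : ℕ :=
  {s : Finset V | G.IsNIndepSet k s}.ncard

/-- The independence polynomial `I(G; x) = ∑_{k = 0}^{α(G)} s_k(G) x ^ k`. -/
noncomputable def indepPoly {V : Type*} (G : SimpleGraph V) : Polynomial ℕ :=
  ∑ k ∈ Finset.range (G.indepNum + 1), Polynomial.monomial k (indepCount G k)

/-- The coefficient sequence `(a_0, …, a_d)`, `d = deg P`, rises weakly up to some index `m` and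
falls weakly from there on. -/
def IsUnimodalPoly (P : Polynomial ℕ) : Prop :=
  ∃ m ≤ P.natDegree,
    (∀ i < m, P.coeff i ≤ P.coeff (i + 1)) ∧
    (∀ i, m ≤ i → i < P.natDegree → P.coeff (i + 1) ≤ P.coeff i)

/-- The coefficient sequence `(a_0, …, a_d)`, `d = deg P`, satisfies
`a_i ^ 2 ≥ a_{i - 1} a_{i + 1}` for `1 ≤ i ≤ d - 1`. -/
def IsLogConcavePoly (P : Polynomial ℕ) : Prop :=
  ∀ i, 1 ≤ i → i + 1 ≤ P.natDegree → P.coeff (i - 1) * P.coeff (i + 1) ≤ P.coeff i ^ 2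

/-! ### One-edge enlargements -/

/-- The nonedges of `G`: unordered pairs of distinct nonadjacent vertices. -/
def nonedges {V : Type*} (G : SimpleGraph V) : Set (Sym2 V) := Gᶜ.edgeSet

/-- The graph `G + e`. -/
def addEdge {V : Type*} (G : SimpleGraph V) (e : Sym2 V) : SimpleGraph V :=
  G ⊔ SimpleGraph.fromEdgeSet {e}

/-- The number of one-edge enlargements `G + e`, one for each nonedge `e` of `G`. -/
noncomputable def numEnlargements {V : Type*} (G : SimpleGraph V) : ℕ :=
  (nonedges G).ncard

/-- The number of nonedges `e` of `G` for which `I(G + e; x)` is log-concave. -/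
noncomputable def numLogConcaveEnlargements {V : Type*} (G : SimpleGraph V) : ℕ :=
  {e ∈ nonedges G | IsLogConcavePoly (indepPoly (addEdge G e))}.ncard

/-! ### The Kadrawi–Levit trees

All trees needed have a root `v₀` with three children `v₁, v₂, v₃`, to which pendant paths
("arms") are attached by an end vertex. Such a tree is described by `L : Fin 3 → List ℕ`, where
`L i` lists the numbers of vertices of the arms at the `i`-th child (`i = 0, 1, 2`). -/

/-- The vertices: the root, its three children, and the `p`-th vertex (counted from `0`, starting
next to the child) on the `j`-th arm at the `i`-th child. -/
inductive ArmVertex (L : Fin 3 → List ℕ) : Type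
  | root : ArmVertex L
  | child (i : Fin 3) : ArmVertex L
  | arm (i : Fin 3) (j : Fin (L i).length) (p : Fin (L i)[j]) : ArmVertex L
  deriving DecidableEq, Fintype

/-- `ArmParent L x y`: `x` is the parent of `y`. -/
def ArmParent (L : Fin 3 → List ℕ) : ArmVertex L → ArmVertex L → Prop
  | .root, .child _ => True
  | .child i, .arm i' _ p => i = i' ∧ (p : ℕ) = 0
  | .arm i j p, .arm i' j' p' => i = i' ∧ (j : ℕ) = j' ∧ (p' : ℕ) = p + 1
  | _, _ => False

/-- The tree described by `L`. -/
def armTree (L : Fin 3 → List ℕ) : SimpleGraph (ArmVertex L) :=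
  SimpleGraph.fromRel (ArmParent L)

/-- Arm data of `T_{3,m,n}`: three, `m` and `n` arms `P₂` at `v₁`, `v₂`, `v₃`. -/
def klArms (m n : ℕ) : Fin 3 → List ℕ :=
  ![[2, 2, 2], List.replicate m 2, List.replicate n 2]

/-- Arm data of `T*_{3,m,n}`: as `T_{3,m,n}`, with one arm `P₂` at `v₁` replaced by a pendant
`P₄`. -/
def klStarArms (m n : ℕ) : Fin 3 → List ℕ :=
  ![[4, 2, 2], List.replicate m 2, List.replicate n 2]

/-- The seven tested collections of Kadrawi–Levit trees (given by their arm data). -/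
def testedCollection : Fin 7 → Finset (Fin 3 → List ℕ) :=
  ![(Finset.Icc 4 12).image (fun k => klArms k k),
    (Finset.Icc 4 9).image (fun k => klArms k (k + 1)),
    (Finset.Icc 4 9).image (fun k => klArms k (k + 2)),
    (Finset.Icc 3 8).image (fun k => klStarArms k (k + 1)),
    (Finset.Icc 4 9).image (fun k => klStarArms (k - 1) (k + 1)),
    (Finset.Icc 4 9).image (fun k => klStarArms k k),
    (Finset.Icc 4 9).image (fun k => klStarArms k (k + 3))]

/-! The theorem is a finite computation, arranged so that the kernel can carry it out. The
independent sets of `G + uv` are those of `G` that do not contain both `u` and `v`, so `I(G + uv)`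
is `I(G)` minus the part of `I(G)` counting sets through `u` and `v` (`indepSum_addEdge`).
Everything is evaluated at one integer `B = 2 ^ 64`. The trees have fewer than 64 vertices, so every
coefficient is below `B` and the base-`B` digits of the value are the coefficients
(`getD_lowDigits`).

What remains is the multiset of subtracted values over all pairs `{u, v}`. The usual recursion for
independent sets of a rooted tree is run on all markings at once. Equal states are merged with
multiplicity, so the many identical arms yield few states, and states with more than two marks are
dropped. `collectsStates_armStates` shows that the list records the recursive values of all markings
with at most two marks; `armVal_fst` and `indepSum_armTree` identify these values with sums over
independent sets. Adjacent pairs are exactly those of value zero (`indepSum_pair_eq_zero_iff`), so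
counting nonzero values counts nonedges. The remaining Boolean and numerical facts are evaluated by
`decide +kernel`. -/

/-! ### Marked rooted trees

A *marking* of a rooted tree selects the vertices that an independent set is required to contain.
The state of a marked rooted forest is the triple `(k, a, b)`: `k` marked vertices, and `a`
(resp. `b`) the sum of `B ^ |S|` over the independent sets `S` containing all marked vertices
(resp. of those that moreover avoid the roots). States are collected in lists with
multiplicities. -/

/-- Values of a rooted tree from the value of the forest below its root, which is marked
according to `f`. -/
def rootStep (B : ℕ) (f : Bool) (p : ℕ × ℕ) : ℕ × ℕ :=
  -- An occupied root contributes `B` and forces the roots below to be avoided; a free root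
  -- contributes only if it is unmarked.
  (cond f 0 p.1 + B * p.2, cond f 0 p.1)

/-- Add a state with a multiplicity to a list of states with multiplicities. -/
def insertState (s : ℕ × ℕ × ℕ) (m : ℕ) : List ((ℕ × ℕ × ℕ) × ℕ) → List ((ℕ × ℕ × ℕ) × ℕ)
  | [] => [(s, m)]
  | (t, n) :: l =>
    cond (Nat.beq s.1 t.1 && (Nat.beq s.2.1 t.2.1 && Nat.beq s.2.2 t.2.2))
      ((t, n + m) :: l) ((t, n) :: insertState s m l)

/-- States of the disjoint union of two marked rooted forests, up to two marked vertices. -/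
def stateMul (X Y : List ((ℕ × ℕ × ℕ) × ℕ)) : List ((ℕ × ℕ × ℕ) × ℕ) :=
  X.foldr (fun e l => Y.foldr (fun e' l =>
    cond (Nat.ble (e.1.1 + e'.1.1) 2)
      (insertState (e.1.1 + e'.1.1, e.1.2.1 * e'.1.2.1, e.1.2.2 * e'.1.2.2) (e.2 * e'.2) l) l) l) []

/-- States of the rooted trees obtained by joining a new root to a marked rooted forest. -/
def stateRoot (B : ℕ) (X : List ((ℕ × ℕ × ℕ) × ℕ)) : List ((ℕ × ℕ × ℕ) × ℕ) :=
  X.foldr (fun e l =>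
    ((e.1.1, rootStep B false e.1.2), e.2) :: ((e.1.1 + 1, rootStep B true e.1.2), e.2) :: l) []

/-- The states of the empty forest. -/
def stateOne : List ((ℕ × ℕ × ℕ) × ℕ) := [((0, 1, 1), 1)]

/-- The states of the marked paths with `n` vertices, rooted at an end. -/
def pathStates (B : ℕ) : ℕ → List ((ℕ × ℕ × ℕ) × ℕ)
  | 0 => stateOne
  | n + 1 => stateRoot B (pathStates B n)

/-- The states of a disjoint union. -/
def stateProd (l : List (List ((ℕ × ℕ × ℕ) × ℕ))) : List ((ℕ × ℕ × ℕ) × ℕ) :=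
  l.foldr stateMul stateOne

/-- The states of the markings of `armTree L`. -/
def armStates (B : ℕ) (L : Fin 3 → List ℕ) : List ((ℕ × ℕ × ℕ) × ℕ) :=
  stateRoot B (stateProd [stateRoot B (stateProd ((L 0).map (pathStates B))),
    stateRoot B (stateProd ((L 1).map (pathStates B))),
    stateRoot B (stateProd ((L 2).map (pathStates B)))])

/-- Total multiplicity of the states with two marked vertices and a value satisfying `Q`. -/
def countStates (Q : ℕ → Bool) (X : List ((ℕ × ℕ × ℕ) × ℕ)) : ℕ :=
  X.foldr (fun e n => cond (Nat.beq e.1.1 2 && Q e.1.2.1) (e.2 + n) n) 0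

/-- The digits of `N` to the base `B`, at most `K` of them. -/
def lowDigits (B : ℕ) : ℕ → ℕ → List ℕ
  | 0, _ => []
  | K + 1, N => cond (Nat.beq N 0) [] (N % B :: lowDigits B K (N / B))

/-- Log-concavity of a list. -/
def logConcaveList : List ℕ → Bool
  | a :: b :: c :: l => Nat.ble (a * c) (b * b) && logConcaveList (b :: c :: l)
  | _ => true

/-- The list falls weakly. -/
def fallingList : List ℕ → Bool
  | a :: b :: l => Nat.ble b a && fallingList (b :: l)
  | _ => true

/-- Unimodality of a list. -/
def unimodalList : List ℕ → Bool
  | a :: b :: l => cond (Nat.ble a b) (unimodalList (b :: l)) (fallingList (a :: b :: l))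
  | _ => true

/-- The value of `armTree L` without marks. -/
def armValue (B : ℕ) (L : Fin 3 → List ℕ) : ℕ :=
  (rootStep B false
    ((List.map (fun l : List ℕ => rootStep B false
      ((l.map fun n => (rootStep B false)^[n] (1, 1)).prod)) [L 0, L 1, L 2]).prod)).1

/-! ### Correctness of the lists of states -/

/-- The sum of `g` over a list of states with multiplicities. -/
def stateSum (X : List ((ℕ × ℕ × ℕ) × ℕ)) (g : ℕ × ℕ × ℕ → ℕ) : ℕ :=
  (X.map fun e => e.2 * g e.1).sum

@[simp] theorem stateSum_nil (g : ℕ × ℕ × ℕ → ℕ) : stateSum [] g = 0 := rfl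

@[simp] theorem stateSum_cons (e : (ℕ × ℕ × ℕ) × ℕ) (X : List ((ℕ × ℕ × ℕ) × ℕ))
    (g : ℕ × ℕ × ℕ → ℕ) : stateSum (e :: X) g = e.2 * g e.1 + stateSum X g := by
  simp [stateSum]

theorem stateSum_insertState (s : ℕ × ℕ × ℕ) (m : ℕ) (X : List ((ℕ × ℕ × ℕ) × ℕ))
    (g : ℕ × ℕ × ℕ → ℕ) : stateSum (insertState s m X) g = m * g s + stateSum X g := by
  induction X with
  | nil => simp [insertState]
  | cons e X ih =>
    obtain ⟨t, n⟩ := e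
    rw [insertState]
    cases h : (Nat.beq s.1 t.1 && (Nat.beq s.2.1 t.2.1 && Nat.beq s.2.2 t.2.2))
    · simp only [cond_false, stateSum_cons, ih]; ring
    · simp only [Bool.and_eq_true, Nat.beq_eq] at h
      obtain rfl : s = t := Prod.ext h.1 (Prod.ext h.2.1 h.2.2)
      simp only [cond_true, stateSum_cons]; ring

/-- Marks only accumulate, so the states discarded in the product are invisible to a `g` vanishing
beyond two marks. -/
theorem stateSum_stateMul (X Y : List ((ℕ × ℕ × ℕ) × ℕ)) (g : ℕ × ℕ × ℕ → ℕ)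
    (hg : ∀ s, 2 < s.1 → g s = 0) :
    stateSum (stateMul X Y) g =
      stateSum X fun s => stateSum Y fun t => g (s.1 + t.1, s.2 * t.2) := by
  have inner : ∀ (e : (ℕ × ℕ × ℕ) × ℕ) (Y l : List ((ℕ × ℕ × ℕ) × ℕ)),
      stateSum (Y.foldr (fun e' l => cond (Nat.ble (e.1.1 + e'.1.1) 2)
        (insertState (e.1.1 + e'.1.1, e.1.2.1 * e'.1.2.1, e.1.2.2 * e'.1.2.2) (e.2 * e'.2) l) l)
        l) g = e.2 * (stateSum Y fun t => g (e.1.1 + t.1, e.1.2 * t.2)) + stateSum l g := by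
    intro e Y l
    induction Y with
    | nil => simp
    | cons e' Y ih =>
      rw [List.foldr_cons, stateSum_cons]
      cases h : Nat.ble (e.1.1 + e'.1.1) 2
      · rw [cond_false, ih, hg (e.1.1 + e'.1.1, e.1.2 * e'.1.2)]
        · simp
        · by_contra h'
          rw [Nat.ble_eq_true_of_le (by simpa using h')] at h
          cases h
      · rw [cond_true, stateSum_insertState, ih, ← Prod.mk_mul_mk]
        ring
  rw [stateMul]
  induction X with
  | nil => rfl
  | cons e X ih => rw [List.foldr_cons, inner, ih, stateSum_cons]

theorem stateSum_stateRoot (B : ℕ) (X : List ((ℕ × ℕ × ℕ) × ℕ)) (g : ℕ × ℕ × ℕ → ℕ) :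
    stateSum (stateRoot B X) g = stateSum X fun s =>
      g (s.1, rootStep B false s.2) + g (s.1 + 1, rootStep B true s.2) := by
  rw [stateRoot]
  induction X with
  | nil => rfl
  | cons e X ih => rw [List.foldr_cons, stateSum_cons, stateSum_cons, ih, stateSum_cons]; ring

/-- The list `X` collects the states `st x`, up to two marked vertices. -/
def CollectsStates (X : List ((ℕ × ℕ × ℕ) × ℕ)) {ι : Type*} [Fintype ι]
    (size : ι → ℕ) (val : ι → ℕ × ℕ) : Prop :=
  -- Testing against all such `g` expresses equality of truncated multisets, regardless of how the
  -- list groups equal states.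
  ∀ g : ℕ × ℕ × ℕ → ℕ, (∀ s, 2 < s.1 → g s = 0) → ∑ x, g (size x, val x) = stateSum X g

theorem CollectsStates.congr {X : List ((ℕ × ℕ × ℕ) × ℕ)} {ι κ : Type*} [Fintype ι] [Fintype κ]
    {size : ι → ℕ} {val : ι → ℕ × ℕ} (h : CollectsStates X size val) (e : κ ≃ ι)
    {size' : κ → ℕ} {val' : κ → ℕ × ℕ} (hs : ∀ x, size' x = size (e x))
    (hv : ∀ x, val' x = val (e x)) : CollectsStates X size' val' := fun g hg => by
  rw [← h g hg]
  exact Fintype.sum_equiv e _ _ fun x => by rw [hs, hv]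

theorem collectsStates_one {ι : Type*} [Fintype ι] [Unique ι] :
    CollectsStates stateOne (fun _ : ι => 0) (fun _ => 1) := fun g _ => by
  simp [stateOne, Prod.one_eq_mk]

theorem CollectsStates.mul {X Y : List ((ℕ × ℕ × ℕ) × ℕ)} {ι κ : Type*} [Fintype ι] [Fintype κ]
    {size : ι → ℕ} {val : ι → ℕ × ℕ} {size' : κ → ℕ} {val' : κ → ℕ × ℕ}
    (hX : CollectsStates X size val) (hY : CollectsStates Y size' val') :
    CollectsStates (stateMul X Y) (fun x : ι × κ => size x.1 + size' x.2)
      (fun x => val x.1 * val' x.2) := fun g hg => by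
  rw [stateSum_stateMul _ _ _ hg, Fintype.sum_prod_type, ← hX]
  · refine Finset.sum_congr rfl fun x _ => ?_
    rw [← hY]
    intro s hs
    exact hg _ (by simp only; omega)
  · intro s hs
    rw [← hY]
    · exact Finset.sum_eq_zero fun y _ => hg _ (by simp only; omega)
    · intro t ht
      exact hg _ (by simp only; omega)

theorem CollectsStates.root {X : List ((ℕ × ℕ × ℕ) × ℕ)} {ι : Type*} [Fintype ι]
    {size : ι → ℕ} {val : ι → ℕ × ℕ} (hX : CollectsStates X size val) (B : ℕ) :
    CollectsStates (stateRoot B X) (fun x : Bool × ι => x.1.toNat + size x.2)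
      (fun x => rootStep B x.1 (val x.2)) := fun g hg => by
  rw [stateSum_stateRoot, Fintype.sum_prod_type_right, ← hX]
  · refine Finset.sum_congr rfl fun x _ => ?_
    rw [Fintype.sum_bool, add_comm]
    simp [add_comm]
  · intro s hs
    rw [hg (s.1, rootStep B false s.2) hs, hg _ (by simp only; omega)]

theorem CollectsStates.pi {n : ℕ} {ι : Fin n → Type*} [∀ i, Fintype (ι i)]
    {X : Fin n → List ((ℕ × ℕ × ℕ) × ℕ)} {size : ∀ i, ι i → ℕ} {val : ∀ i, ι i → ℕ × ℕ}
    (h : ∀ i, CollectsStates (X i) (size i) (val i)) :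
    CollectsStates (stateProd (List.ofFn X)) (fun x : ∀ i, ι i => ∑ i, size i (x i))
      (fun x => ∏ i, val i (x i)) := by
  induction n with
  | zero => simpa [stateProd] using collectsStates_one (ι := ∀ i, ι i)
  | succ n ih =>
    rw [List.ofFn_succ]
    refine ((h 0).mul (ih fun i => h i.succ)).congr (Fin.consEquiv ι).symm ?_ ?_
    · intro x; rw [Fin.sum_univ_succ]; rfl
    · intro x; rw [Fin.prod_univ_succ]; rfl

/-- The values of a path marked by `F`. -/
def pathVal (B : ℕ) : ∀ n, (Fin n → Bool) → ℕ × ℕ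
  | 0, _ => 1
  | n + 1, F => rootStep B (F 0) (pathVal B n fun p => F p.succ)

theorem collectsStates_path (B n : ℕ) :
    CollectsStates (pathStates B n) (fun F : Fin n → Bool => ∑ p, (F p).toNat)
      (pathVal B n) := by
  induction n with
  | zero => simpa [pathStates, pathVal] using collectsStates_one (ι := Fin 0 → Bool)
  | succ n ih =>
    refine (ih.root B).congr (Fin.consEquiv fun _ => Bool).symm ?_ ?_
    · intro x; rw [Fin.sum_univ_succ]; rfl
    · intro x; rfl

/-- `ArmVertex L` as a sum type. -/
def armVertexEquiv (L : Fin 3 → List ℕ) :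
    ArmVertex L ≃ Unit ⊕ (Fin 3) ⊕ (Σ i, Σ j : Fin (L i).length, Fin (L i)[j]) where
  toFun
    | .root => .inl ()
    | .child i => .inr (.inl i)
    | .arm i j p => .inr (.inr ⟨i, j, p⟩)
  invFun
    | .inl _ => .root
    | .inr (.inl i) => .child i
    | .inr (.inr ⟨i, j, p⟩) => .arm i j p
  left_inv v := by cases v <;> rfl
  right_inv v := by rcases v with _ | _ | ⟨_, _, _⟩ <;> rfl

theorem ArmVertex.prod_univ {M : Type*} [CommMonoid M] {L : Fin 3 → List ℕ}
    (f : ArmVertex L → M) :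
    ∏ v, f v = f .root * ∏ i, (f (.child i) * ∏ j, ∏ p, f (.arm i j p)) := by
  rw [Fintype.prod_equiv (armVertexEquiv L) f (fun v => f ((armVertexEquiv L).symm v))
    (fun v => by rw [Equiv.symm_apply_apply])]
  rw [Fintype.prod_sum_type, Fintype.prod_sum_type, Finset.prod_mul_distrib, Fintype.prod_sigma]
  simp only [Fintype.prod_sigma]
  simp [armVertexEquiv]

theorem ArmVertex.sum_univ {M : Type*} [AddCommMonoid M] {L : Fin 3 → List ℕ}
    (f : ArmVertex L → M) :
    ∑ v, f v = f .root + ∑ i, (f (.child i) + ∑ j, ∑ p, f (.arm i j p)) :=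
  ArmVertex.prod_univ (M := Multiplicative M) f

/-- Splitting a function on `ArmVertex L` into its values at the root, at the children and on the
arms. -/
def armFunEquiv (L : Fin 3 → List ℕ) :
    (ArmVertex L → Bool) ≃
      Bool × (∀ i : Fin 3, Bool × (∀ j : Fin (L i).length, Fin (L i)[j] → Bool)) where
  toFun F := (F .root, fun i => (F (.child i), fun j p => F (.arm i j p)))
  invFun x
    | .root => x.1
    | .child i => (x.2 i).1
    | .arm i j p => (x.2 i).2 j p
  left_inv F := by funext v; cases v <;> rfl
  right_inv x := rfl

/-- The values of `armTree L` marked by `F`. -/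
def armVal (B : ℕ) {L : Fin 3 → List ℕ} (F : ArmVertex L → Bool) : ℕ × ℕ :=
  rootStep B (F .root) (∏ i, rootStep B (F (.child i)) (∏ j, pathVal B _ fun p => F (.arm i j p)))

theorem collectsStates_armStates (B : ℕ) (L : Fin 3 → List ℕ) :
    CollectsStates (armStates B L) (fun F : ArmVertex L → Bool => ∑ v, (F v).toNat)
      (armVal B) := by
  have h (i : Fin 3) : CollectsStates (stateRoot B (stateProd ((L i).map (pathStates B))))
      (fun x : Bool × (∀ j : Fin (L i).length, Fin (L i)[j] → Bool) =>
        x.1.toNat + ∑ j, ∑ p, (x.2 j p).toNat)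
      (fun x => rootStep B x.1 (∏ j, pathVal B _ (x.2 j))) := by
    have e : (L i).map (pathStates B) = List.ofFn fun j : Fin (L i).length =>
        pathStates B (L i)[j] := by
      conv_lhs => rw [← List.ofFn_getElem (xs := L i), List.map_ofFn]
      rfl
    rw [e]
    exact (CollectsStates.pi fun j => collectsStates_path B (L i)[j]).root B
  have h' := (CollectsStates.pi h).root B
  rw [List.ofFn_succ, List.ofFn_succ, List.ofFn_succ, List.ofFn_zero] at h'
  refine h'.congr (armFunEquiv L) ?_ fun F => rfl
  intro F; rw [ArmVertex.sum_univ]; rfl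

/-! ### Transfer along the tree -/

/-- The entry of a pair of values for a forest below an occupied (`true`) or free vertex. -/
def valAt (c : Bool) (p : ℕ × ℕ) : ℕ := cond c p.2 p.1

/-- The weight of a vertex with mark `f` and occupation `s`. -/
def vertexWeight (B : ℕ) (f s : Bool) : ℕ := cond s B (cond f 0 1)

theorem valAt_prod {ι : Type*} [Fintype ι] (c : Bool) (p : ι → ℕ × ℕ) :
    valAt c (∏ i, p i) = ∏ i, valAt c (p i) := by
  cases c
  · exact Prod.fst_prod
  · exact Prod.snd_prod

/-- The transfer-matrix form of the recursion: `c` is the occupation of the vertex above, `s` that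
of the root, and the two may not both be occupied. -/
theorem valAt_rootStep (B : ℕ) (c f : Bool) (p : ℕ × ℕ) :
    valAt c (rootStep B f p) =
      ∑ s : Bool, if ¬ (c ∧ s) then vertexWeight B f s * valAt s p else 0 := by
  rw [Fintype.sum_bool]
  cases c <;> cases f <;> simp [valAt, rootStep, vertexWeight, add_comm]

/-- `g` is independent on the path hanging below a vertex with occupation `c`. -/
def PathIndep : ∀ n, Bool → (Fin n → Bool) → Prop
  | 0, _, _ => True
  | n + 1, c, g => ¬ (c ∧ g 0) ∧ PathIndep n (g 0) fun p => g p.succ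

theorem pathIndep_iff (n : ℕ) (c : Bool) (g : Fin n → Bool) :
    PathIndep n c g ↔ (∀ p : Fin n, (p : ℕ) = 0 → ¬ (c ∧ g p)) ∧
      ∀ p p' : Fin n, (p' : ℕ) = p + 1 → ¬ (g p ∧ g p') := by
  induction n generalizing c with
  | zero => simp [PathIndep]
  | succ n ih =>
    rw [PathIndep, ih]
    simp only [Fin.forall_fin_succ, Fin.val_succ, Fin.val_zero]
    simp

open Classical in
theorem valAt_pathVal (B n : ℕ) (c : Bool) (F : Fin n → Bool) :
    valAt c (pathVal B n F) =
      ∑ g : Fin n → Bool, if PathIndep n c g then ∏ p, vertexWeight B (F p) (g p) else 0 := by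
  induction n generalizing c with
  | zero => cases c <;> simp [PathIndep, pathVal, valAt]
  | succ n ih =>
    rw [pathVal, valAt_rootStep, ← (Fin.consEquiv fun _ => Bool).sum_comp, Fintype.sum_prod_type]
    refine Finset.sum_congr rfl fun s _ => ?_
    rw [ih]
    by_cases h : c ∧ s
    · rw [if_neg (not_not.2 h)]
      symm
      refine Finset.sum_eq_zero fun g _ => if_neg fun h' => h'.1 ?_
      simpa [Fin.consEquiv] using h
    · rw [if_pos h, Finset.mul_sum]
      refine Finset.sum_congr rfl fun g _ => ?_
      rw [Fin.prod_univ_succ]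
      simp [PathIndep, Fin.consEquiv, h]

open Classical in
-- Once the occupation of the child is fixed, its arms do not interact, so the product of the sums
-- over arms expands into one sum over joint configurations.
theorem valAt_branch (B : ℕ) {l : List ℕ} (c m : Bool)
    (F : ∀ j : Fin l.length, Fin l[j] → Bool) :
    valAt c (rootStep B m (∏ j, pathVal B _ (F j))) =
      ∑ x : Bool × (∀ j : Fin l.length, Fin l[j] → Bool),
        if ¬ (c ∧ x.1) ∧ ∀ j, PathIndep _ x.1 (x.2 j) then
          vertexWeight B m x.1 * ∏ j, ∏ p, vertexWeight B (F j p) (x.2 j p) else 0 := by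
  rw [valAt_rootStep, Fintype.sum_prod_type]
  refine Finset.sum_congr rfl fun s _ => ?_
  by_cases h : c ∧ s
  · simp [h]
  · simp only [h, not_false_eq_true, if_true, true_and, valAt_prod, valAt_pathVal]
    rw [Finset.prod_univ_sum, Fintype.piFinset_univ, Finset.mul_sum]
    refine Finset.sum_congr rfl fun g _ => ?_
    rw [Finset.prod_ite_zero, mul_ite, mul_zero]
    simp only [Finset.mem_univ, true_imp_iff]

/-- `f` is independent in the tree described by `L`. -/
def ArmIndep {L : Fin 3 → List ℕ} (f : ArmVertex L → Bool) : Prop :=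
  ∀ x y, ArmParent L x y → ¬ (f x ∧ f y)

theorem armIndep_iff {L : Fin 3 → List ℕ} (f : ArmVertex L → Bool) :
    ArmIndep f ↔ ∀ i, ¬ (f .root ∧ f (.child i)) ∧
      ∀ j, PathIndep _ (f (.child i)) fun p => f (.arm i j p) := by
  simp only [pathIndep_iff]
  constructor
  · intro h i
    refine ⟨h _ _ trivial, fun j => ⟨fun p hp => h _ _ ⟨rfl, hp⟩, fun p p' hp => ?_⟩⟩
    exact h (.arm i j p) (.arm i j p') ⟨rfl, rfl, hp⟩
  · rintro h (_ | i | ⟨i, j, p⟩) (_ | i' | ⟨i', j', p'⟩) hxy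
    all_goals try exact hxy.elim
    · exact (h i').1
    · obtain ⟨rfl, hp⟩ := hxy
      exact ((h i).2 j').1 p' hp
    · obtain ⟨rfl, hj, hp⟩ := hxy
      obtain rfl := Fin.ext hj
      exact ((h i).2 j).2 p p' hp

open Classical in
theorem armVal_fst (B : ℕ) {L : Fin 3 → List ℕ} (F : ArmVertex L → Bool) :
    (armVal B F).1 =
      ∑ f : ArmVertex L → Bool, if ArmIndep f then ∏ v, vertexWeight B (F v) (f v) else 0 := by
  -- The root has nothing above it, which amounts to a free parent.
  change valAt false (armVal B F) = _
  rw [armVal, valAt_rootStep, ← (armFunEquiv L).symm.sum_comp, Fintype.sum_prod_type]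
  refine Finset.sum_congr rfl fun r _ => ?_
  rw [if_pos (by simp), valAt_prod]
  simp only [valAt_branch]
  rw [Finset.prod_univ_sum, Fintype.piFinset_univ, Finset.mul_sum]
  refine Finset.sum_congr rfl fun g _ => ?_
  rw [Finset.prod_ite_zero, mul_ite, mul_zero, ArmVertex.prod_univ]
  simp only [Finset.mem_univ, true_imp_iff, armIndep_iff]
  rfl

/-! ### Independence numbers as digits -/

/-- The independent sets of `G` containing `A`. -/
noncomputable def indepSupersets {V : Type*} [Fintype V] (G : SimpleGraph V) (A : Finset V) :
    Finset (Finset V) :=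
  (Set.toFinite {S : Finset V | G.IsIndepSet (S : Set V) ∧ A ⊆ S}).toFinset

@[simp] theorem mem_indepSupersets {V : Type*} [Fintype V] {G : SimpleGraph V} {A S : Finset V} :
    S ∈ indepSupersets G A ↔ G.IsIndepSet (S : Set V) ∧ A ⊆ S := by
  simp [indepSupersets]

/-- The sum of `B ^ |S|` over the independent sets `S` of `G` containing `A`. -/
noncomputable def indepSum {V : Type*} [Fintype V] (B : ℕ) (G : SimpleGraph V) (A : Finset V) : ℕ :=
  ∑ S ∈ indepSupersets G A, B ^ S.card

theorem armTree_isIndepSet_iff {L : Fin 3 → List ℕ} (S : Finset (ArmVertex L)) :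
    (armTree L).IsIndepSet (S : Set (ArmVertex L)) ↔ ArmIndep fun v => decide (v ∈ S) := by
  have hne : ∀ x y, ArmParent L x y → x ≠ y := by
    rintro (_ | i | ⟨i, j, p⟩) (_ | i' | ⟨i', j', p'⟩) h h'
    all_goals first | exact h.elim | cases h'
    have := h.2.2
    omega
  simp only [SimpleGraph.IsIndepSet, Set.Pairwise, armTree, SimpleGraph.fromRel_adj, ArmIndep,
    decide_eq_true_eq, Finset.mem_coe]
  constructor
  · intro h x y hxy hS
    exact h hS.1 hS.2 (hne x y hxy) ⟨hne x y hxy, Or.inl hxy⟩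
  · rintro h x hx y hy - ⟨-, hxy | hxy⟩
    · exact h x y hxy ⟨hx, hy⟩
    · exact h y x hxy ⟨hy, hx⟩

theorem indepSum_armTree (B : ℕ) {L : Fin 3 → List ℕ} (A : Finset (ArmVertex L)) :
    indepSum B (armTree L) A = (armVal B fun v => decide (v ∈ A)).1 := by
  classical
  have e : indepSupersets (armTree L) A = Finset.univ.filter fun S : Finset (ArmVertex L) =>
      (ArmIndep fun v => decide (v ∈ S)) ∧ A ⊆ S := by
    ext S
    rw [mem_indepSupersets, armTree_isIndepSet_iff, Finset.mem_filter_univ]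
  rw [armVal_fst, indepSum, e, Finset.sum_filter]
  refine Fintype.sum_bijective (fun S : Finset (ArmVertex L) => fun v => decide (v ∈ S))
    ⟨fun S T h => ?_, fun f => ⟨Finset.univ.filter fun v => f v, by simp⟩⟩ _ _ fun S => ?_
  · ext v
    simpa using congrFun h v
  · rw [ite_and]
    refine if_congr Iff.rfl ?_ rfl
    -- A weight vanishes at a marked vertex outside `S`, so the product of weights is `B ^ |S|` if
    -- `A ⊆ S` and `0` otherwise.
    have hw : ∀ v, vertexWeight B (decide (v ∈ A)) (decide (v ∈ S)) =
        if v ∈ A → v ∈ S then (if v ∈ S then B else 1) else 0 := by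
      intro v
      by_cases h1 : v ∈ A <;> by_cases h2 : v ∈ S <;> simp [vertexWeight, h1, h2]
    simp only [hw, Finset.prod_ite_zero, Finset.mem_univ, true_imp_iff]
    refine if_congr Iff.rfl ?_ rfl
    rw [Finset.prod_ite]
    simp

theorem indepSum_addEdge {V : Type*} [Fintype V] [DecidableEq V] (B : ℕ) (G : SimpleGraph V)
    {u v : V} (huv : u ≠ v) :
    indepSum B (addEdge G s(u, v)) ∅ = indepSum B G ∅ - indepSum B G {u, v} := by
  classical
  refine (Nat.sub_eq_of_eq_add ?_).symm
  simp only [indepSum]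
  rw [← Finset.sum_union]
  · refine Finset.sum_congr ?_ fun _ _ => rfl
    ext S
    simp only [mem_indepSupersets, Finset.empty_subset, and_true, Finset.mem_union,
      Finset.insert_subset_iff, Finset.singleton_subset_iff]
    constructor
    · intro h
      by_cases hS : u ∈ S ∧ v ∈ S
      · exact Or.inr ⟨h, hS⟩
      · refine Or.inl fun x hx y hy hxy hadj => ?_
        rcases hadj with hadj | hadj
        · exact h hx hy hxy hadj
        · simp only [SimpleGraph.fromEdgeSet_adj, Set.mem_singleton_iff, Sym2.eq_iff] at hadj
          rcases hadj.1 with ⟨rfl, rfl⟩ | ⟨rfl, rfl⟩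
          · exact hS ⟨hx, hy⟩
          · exact hS ⟨hy, hx⟩
    · rintro (h | h)
      · exact fun x hx y hy hxy hadj => h hx hy hxy (Or.inl hadj)
      · exact h.1
  · refine Finset.disjoint_left.2 fun S hS hS' => ?_
    have h := (mem_indepSupersets.1 hS).1
    have h' := (mem_indepSupersets.1 hS').2
    rw [Finset.insert_subset_iff, Finset.singleton_subset_iff] at h'
    exact h h'.1 h'.2 huv (Or.inr (by simp [huv]))

/-- If `u` and `v` are nonadjacent, `{u, v}` itself contributes a positive term. -/
theorem indepSum_pair_eq_zero_iff {V : Type*} [Fintype V] [DecidableEq V] {B : ℕ} (hB : 0 < B)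
    (G : SimpleGraph V) {u v : V} (huv : u ≠ v) :
    indepSum B G {u, v} = 0 ↔ G.Adj u v := by
  classical
  simp only [indepSum, Finset.sum_eq_zero_iff, mem_indepSupersets]
  constructor
  · intro h
    by_contra hadj
    refine (pow_pos hB _).ne' (h {u, v} ⟨?_, subset_rfl⟩)
    intro x hx y hy hxy hadj'
    simp only [Finset.coe_insert, Finset.coe_singleton, Set.mem_insert_iff,
      Set.mem_singleton_iff] at hx hy
    rcases hx with rfl | rfl <;> rcases hy with rfl | rfl
    · exact hxy rfl
    · exact hadj hadj'
    · exact hadj hadj'.symm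
    · exact hxy rfl
  · rintro hadj S ⟨h, h'⟩
    rw [Finset.insert_subset_iff, Finset.singleton_subset_iff] at h'
    exact (h h'.1 h'.2 huv hadj).elim

theorem indepSum_empty {V : Type*} [Fintype V] (B : ℕ) (G : SimpleGraph V) {K : ℕ}
    (hK : Fintype.card V < K) :
    indepSum B G ∅ = ∑ k ∈ Finset.range K, indepCount G k * B ^ k := by
  classical
  rw [indepSum, ← Finset.sum_fiberwise_of_maps_to (t := Finset.range K) (g := Finset.card)]
  · refine Finset.sum_congr rfl fun k _ => ?_
    rw [Finset.sum_congr rfl (g := fun _ => B ^ k), Finset.sum_const, smul_eq_mul, indepCount,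
      ← Set.ncard_coe_finset]
    · congr 2
      ext S
      simp [SimpleGraph.isNIndepSet_iff]
    · intro S hS
      rw [(Finset.mem_filter.1 hS).2]
  · intro S _
    exact Finset.mem_range.2 ((Finset.card_le_univ S).trans_lt hK)

theorem indepCount_le {V : Type*} [Fintype V] (G : SimpleGraph V) (k : ℕ) :
    indepCount G k ≤ 2 ^ Fintype.card V := by
  classical
  rw [← Fintype.card_finset, ← Nat.card_eq_fintype_card]
  exact Set.ncard_le_card _

theorem getD_lowDigits_sum {B : ℕ} {a : ℕ → ℕ} (ha : ∀ k, a k < B) {K : ℕ}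
    (hK : ∀ k, K ≤ k → a k = 0) (i : ℕ) :
    (lowDigits B K (∑ k ∈ Finset.range K, a k * B ^ k)).getD i 0 = a i := by
  have hB : 0 < B := (Nat.zero_le _).trans_lt (ha 0)
  induction K generalizing a i with
  | zero => simp [lowDigits, hK i (Nat.zero_le i)]
  | succ K ih =>
    have e : ∑ k ∈ Finset.range (K + 1), a k * B ^ k =
        a 0 + B * ∑ k ∈ Finset.range K, a (k + 1) * B ^ k := by
      rw [Finset.sum_range_succ', Finset.mul_sum, add_comm]
      congr 1
      · simp
      · exact Finset.sum_congr rfl fun k _ => by ring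
    rw [lowDigits]
    cases h : Nat.beq (∑ k ∈ Finset.range (K + 1), a k * B ^ k) 0
    · rw [cond_false, e, Nat.add_mul_mod_self_left, Nat.mod_eq_of_lt (ha 0),
        Nat.add_mul_div_left _ _ hB, Nat.div_eq_of_lt (ha 0), zero_add]
      rcases i with _ | i
      · rfl
      · exact ih (fun k => ha (k + 1)) (fun k hk => hK (k + 1) (by omega)) i
    -- The expansion stops early only at the value `0`; all remaining coefficients then vanish, in
    -- agreement with the default of `getD`.
    · by_cases hi : K + 1 ≤ i
      · simp [hK i hi]
      · have h0 := Finset.sum_eq_zero_iff.1 (Nat.eq_of_beq_eq_true h) i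
          (Finset.mem_range.2 (by omega))
        simpa [hB.ne'] using (mul_eq_zero.1 h0).resolve_right (pow_pos hB i).ne' |>.symm

/-! ### Coefficients of the independence polynomial -/

theorem indepCount_eq_zero {V : Type*} [Fintype V] (G : SimpleGraph V) {k : ℕ}
    (hk : G.indepNum < k) : indepCount G k = 0 := by
  rw [indepCount, Set.ncard_eq_zero (Set.toFinite _), Set.eq_empty_iff_forall_notMem]
  intro S hS
  exact hk.not_ge (hS.card_eq ▸ hS.isIndepSet.card_le_indepNum)

theorem indepCount_zero {V : Type*} (G : SimpleGraph V) : indepCount G 0 = 1 := by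
  rw [indepCount, Set.ncard_eq_one]
  refine ⟨∅, Set.ext fun S => ?_⟩
  simp only [SimpleGraph.isNIndepSet_iff, Finset.card_eq_zero, Set.mem_ofPred_eq,
    Set.mem_singleton_iff, and_iff_right_iff_imp]
  rintro rfl
  simp [SimpleGraph.IsIndepSet]

theorem coeff_indepPoly {V : Type*} [Fintype V] (G : SimpleGraph V) (k : ℕ) :
    (indepPoly G).coeff k = indepCount G k := by
  simp only [indepPoly, Polynomial.finsetSum_coeff, Polynomial.coeff_monomial,
    Finset.sum_ite_eq', Finset.mem_range]
  rw [ite_eq_left_iff]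
  intro h
  exact (indepCount_eq_zero G (by omega)).symm

theorem isLogConcavePoly_iff (P : Polynomial ℕ) :
    IsLogConcavePoly P ↔ ∀ i, P.coeff i * P.coeff (i + 2) ≤ P.coeff (i + 1) ^ 2 := by
  constructor
  · intro h i
    by_cases hi : i + 2 ≤ P.natDegree
    · exact h (i + 1) (by omega) hi
    · rw [Polynomial.coeff_eq_zero_of_natDegree_lt (n := i + 2) (by omega), mul_zero]
      exact Nat.zero_le _
  · rintro h (_ | i) hi -
    · omega
    · exact h i

/-- The coefficients climb from a nonzero constant term up to the peak, so the peak is nonzero and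
lies within the degree. -/
theorem isUnimodalPoly_of_forall {P : Polynomial ℕ} (h0 : P.coeff 0 ≠ 0) (m : ℕ)
    (h1 : ∀ i < m, P.coeff i ≤ P.coeff (i + 1)) (h2 : ∀ i, m ≤ i → P.coeff (i + 1) ≤ P.coeff i) :
    IsUnimodalPoly P := by
  refine ⟨m, Polynomial.le_natDegree_of_ne_zero ?_, h1, fun i hi _ => h2 i hi⟩
  have : ∀ i ≤ m, P.coeff 0 ≤ P.coeff i := by
    intro i
    induction i with
    | zero => exact fun _ => le_rfl
    | succ i ih => exact fun hi => (ih (by omega)).trans (h1 i hi)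
  have := this m le_rfl
  omega

theorem logConcaveList_iff (l : List ℕ) :
    logConcaveList l = true ↔ ∀ i, l.getD i 0 * l.getD (i + 2) 0 ≤ l.getD (i + 1) 0 ^ 2 := by
  induction l with
  | nil => simp [logConcaveList]
  | cons a l ih =>
    rcases l with _ | ⟨b, _ | ⟨c, l⟩⟩
    · simp [logConcaveList]
    · simp [logConcaveList]
    · rw [logConcaveList, Bool.and_eq_true, Nat.ble_eq, ih, ← sq]
      constructor
      · rintro ⟨h1, h2⟩ (_ | i)
        · exact h1
        · exact h2 i
      · intro h
        exact ⟨h 0, fun i => h (i + 1)⟩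

theorem fallingList_spec (l : List ℕ) (h : fallingList l = true) (i : ℕ) :
    l.getD (i + 1) 0 ≤ l.getD i 0 := by
  induction l generalizing i with
  | nil => simp
  | cons a l ih =>
    rcases l with _ | ⟨b, l⟩
    · simp
    · rw [fallingList, Bool.and_eq_true, Nat.ble_eq] at h
      rcases i with _ | i
      · exact h.1
      · exact ih h.2 i

theorem unimodalList_spec (l : List ℕ) (h : unimodalList l = true) :
    ∃ m, (∀ i < m, l.getD i 0 ≤ l.getD (i + 1) 0) ∧
      ∀ i, m ≤ i → l.getD (i + 1) 0 ≤ l.getD i 0 := by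
  induction l with
  | nil => exact ⟨0, by simp⟩
  | cons a l ih =>
    rcases l with _ | ⟨b, l⟩
    · exact ⟨0, by simp⟩
    · rw [unimodalList] at h
      cases hab : Nat.ble a b <;> rw [hab] at h
      · exact ⟨0, by simp, fun i _ => fallingList_spec _ h i⟩
      · obtain ⟨m, h1, h2⟩ := ih h
        refine ⟨m + 1, ?_, ?_⟩
        · rintro (_ | i) hi
          · exact Nat.le_of_ble_eq_true hab
          · exact h1 i (by omega)
        · rintro (_ | i) hi
          · omega
          · exact h2 i (by omega)

theorem getD_lowDigits {V : Type*} [Fintype V] {B K : ℕ} (G : SimpleGraph V)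
    (hK : Fintype.card V < K) (hB : 2 ^ Fintype.card V < B) (i : ℕ) :
    (lowDigits B K (indepSum B G ∅)).getD i 0 = (indepPoly G).coeff i := by
  rw [indepSum_empty B G hK, coeff_indepPoly]
  refine getD_lowDigits_sum (fun k => (indepCount_le G k).trans_lt hB) (fun k hk => ?_) i
  refine indepCount_eq_zero G ?_
  obtain ⟨S, hS⟩ := G.exists_isNIndepSet_indepNum
  have := hS.card_eq ▸ Finset.card_le_univ S
  omega

theorem isLogConcavePoly_indepPoly_iff {V : Type*} [Fintype V] {B K : ℕ} (G : SimpleGraph V)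
    (hK : Fintype.card V < K) (hB : 2 ^ Fintype.card V < B) :
    IsLogConcavePoly (indepPoly G) ↔ logConcaveList (lowDigits B K (indepSum B G ∅)) = true := by
  simp only [isLogConcavePoly_iff, logConcaveList_iff, getD_lowDigits G hK hB]

theorem isUnimodalPoly_indepPoly {V : Type*} [Fintype V] {B K : ℕ} (G : SimpleGraph V)
    (hK : Fintype.card V < K) (hB : 2 ^ Fintype.card V < B)
    (h : unimodalList (lowDigits B K (indepSum B G ∅)) = true) :
    IsUnimodalPoly (indepPoly G) := by
  obtain ⟨m, h1, h2⟩ := unimodalList_spec _ h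
  simp only [getD_lowDigits G hK hB] at h1 h2
  exact isUnimodalPoly_of_forall (by simp [coeff_indepPoly, indepCount_zero]) m h1 h2

/-! ### Counting nonedges -/

theorem countStates_eq (Q : ℕ → Bool) (X : List ((ℕ × ℕ × ℕ) × ℕ)) :
    countStates Q X = stateSum X fun s => if s.1 = 2 ∧ Q s.2.1 then 1 else 0 := by
  rw [countStates]
  induction X with
  | nil => rfl
  | cons e X ih =>
    rw [List.foldr_cons, stateSum_cons, ih]
    cases h1 : Nat.beq e.1.1 2
    · simp [Nat.ne_of_beq_eq_false h1]
    · by_cases h2 : Q e.1.2.1 = true <;> simp [Nat.eq_of_beq_eq_true h1, h2]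

theorem card_pairs_eq_countStates (B : ℕ) (L : Fin 3 → List ℕ) (Q : ℕ → Bool) :
    (Finset.univ.filter fun A : Finset (ArmVertex L) =>
      A.card = 2 ∧ Q (indepSum B (armTree L) A)).card = countStates Q (armStates B L) := by
  classical
  rw [countStates_eq, ← collectsStates_armStates B L, Finset.card_filter]
  · refine Fintype.sum_bijective (fun S : Finset (ArmVertex L) => fun v => decide (v ∈ S))
      ⟨fun S T h => ?_, fun f => ⟨Finset.univ.filter fun v => f v, by simp⟩⟩ _ _ fun S => ?_
    · ext v
      simpa using congrFun h v
    · rw [indepSum_armTree]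
      simp [Bool.toNat, Bool.cond_decide]
  · intro s hs
    rw [if_neg]
    rintro ⟨h, -⟩
    omega

/-- The condition `Q 0 = false` removes the adjacent pairs from the count over all two-element sets.
-/
theorem ncard_nonedges_eq_countStates {B : ℕ} (hB : 0 < B) (L : Fin 3 → List ℕ) (Q : ℕ → Bool)
    (hQ : Q 0 = false) {R : Sym2 (ArmVertex L) → Prop}
    (hR : ∀ u v, u ≠ v → ¬ (armTree L).Adj u v →
      (R s(u, v) ↔ Q (indepSum B (armTree L) {u, v}) = true)) :
    {e ∈ nonedges (armTree L) | R e}.ncard = countStates Q (armStates B L) := by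
  rw [← card_pairs_eq_countStates, ← Set.ncard_coe_finset]
  have pair (u v : ArmVertex L) : Sym2.toFinset s(u, v) = {u, v} := by ext; simp
  refine Set.ncard_congr (fun e _ => e.toFinset) ?_ ?_ ?_
  · intro e
    induction e with | _ u v => ?_
    rintro ⟨h, h'⟩
    have h : u ≠ v ∧ ¬ (armTree L).Adj u v := by simpa [nonedges] using h
    simp only [pair, Finset.coe_filter, Finset.mem_univ, true_and, Set.mem_ofPred_eq]
    exact ⟨Finset.card_pair h.1, (hR u v h.1 h.2).1 h'⟩
  · intro e e' _ _ h
    refine Sym2.ext fun v => ?_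
    rw [← Sym2.mem_toFinset, ← Sym2.mem_toFinset, h]
  · intro A hA
    simp only [Finset.coe_filter, Finset.mem_univ, true_and, Set.mem_ofPred_eq] at hA
    obtain ⟨hA, hQA⟩ := hA
    obtain ⟨u, v, huv, rfl⟩ := Finset.card_eq_two.1 hA
    have hadj : ¬ (armTree L).Adj u v := by
      intro h
      rw [(indepSum_pair_eq_zero_iff hB _ huv).2 h, hQ] at hQA
      cases hQA
    refine ⟨s(u, v), ⟨?_, (hR u v huv hadj).2 hQA⟩, ?_⟩
    · simpa [nonedges] using ⟨huv, hadj⟩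
    · exact pair u v

theorem pathVal_unmarked (B n : ℕ) :
    pathVal B n (fun _ => false) = (rootStep B false)^[n] (1, 1) := by
  induction n with
  | zero => rfl
  | succ n ih => rw [Function.iterate_succ_apply', ← ih]; rfl

theorem indepSum_armTree_empty (B : ℕ) (L : Fin 3 → List ℕ) :
    indepSum B (armTree L) ∅ = armValue B L := by
  have h (l : List ℕ) : ∏ j : Fin l.length, (rootStep B false)^[l[j]] (1, 1) =
      (l.map fun n => (rootStep B false)^[n] (1, 1)).prod := by
    conv_rhs => rw [← List.ofFn_getElem (xs := l), List.map_ofFn, List.prod_ofFn]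
    rfl
  rw [indepSum_armTree]
  simp only [Finset.notMem_empty, decide_false, armVal, pathVal_unmarked, h, Fin.prod_univ_three,
    armValue, List.map_cons, List.map_nil, List.prod_cons, List.prod_nil, mul_one, mul_assoc]

/-- The number of vertices of `armTree L`. -/
def armCard (L : Fin 3 → List ℕ) : ℕ := 4 + ((L 0).sum + (L 1).sum + (L 2).sum)

theorem card_armVertex (L : Fin 3 → List ℕ) : Fintype.card (ArmVertex L) = armCard L := by
  have h (l : List ℕ) : ∑ j : Fin l.length, l[j] = l.sum := by
    conv_rhs => rw [← List.ofFn_getElem (xs := l), List.sum_ofFn]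
    rfl
  rw [Fintype.card_eq_sum_ones, ArmVertex.sum_univ]
  simp only [Finset.sum_const, Finset.card_univ, Fintype.card_fin, smul_eq_mul, mul_one, h,
    Fin.sum_univ_three, armCard]
  ring

/-- Base and number of digits used for encoding independence polynomials. -/
abbrev digitBase : ℕ := 2 ^ 64

/-- Encoded independence polynomials as coefficient lists. -/
def decodePoly (N : ℕ) : List ℕ := lowDigits digitBase 64 N

/-- The number of nonedges `e` for which the coefficients of `I(armTree L + e)` satisfy `P`. -/
def countEnlargements (P : List ℕ → Bool) (L : Fin 3 → List ℕ) : ℕ :=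
  countStates (fun a => !Nat.beq a 0 && P (decodePoly (armValue digitBase L - a)))
    (armStates digitBase L)

theorem indepSum_addEdge_armTree (B : ℕ) (L : Fin 3 → List ℕ) {u v : ArmVertex L} (huv : u ≠ v) :
    indepSum B (addEdge (armTree L) s(u, v)) ∅ =
      armValue B L - indepSum B (armTree L) {u, v} := by
  rw [indepSum_addEdge B _ huv, indepSum_armTree_empty]

theorem isLogConcavePoly_iff_decodePoly {L : Fin 3 → List ℕ} (hL : armCard L < 64)
    (G : SimpleGraph (ArmVertex L)) :
    IsLogConcavePoly (indepPoly G) ↔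
      logConcaveList (decodePoly (indepSum digitBase G ∅)) = true := by
  rw [← card_armVertex] at hL
  exact isLogConcavePoly_indepPoly_iff G hL (Nat.pow_lt_pow_right one_lt_two hL)

theorem isUnimodalPoly_of_decodePoly {L : Fin 3 → List ℕ} (hL : armCard L < 64)
    (G : SimpleGraph (ArmVertex L))
    (h : unimodalList (decodePoly (indepSum digitBase G ∅)) = true) :
    IsUnimodalPoly (indepPoly G) := by
  rw [← card_armVertex] at hL
  exact isUnimodalPoly_indepPoly G hL (Nat.pow_lt_pow_right one_lt_two hL) h

theorem ncard_enlargements (P : List ℕ → Bool) (L : Fin 3 → List ℕ) :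
    {e ∈ nonedges (armTree L) |
      P (decodePoly (indepSum digitBase (addEdge (armTree L) e) ∅)) = true}.ncard =
      countEnlargements P L := by
  have hB : 0 < digitBase := by simp
  refine ncard_nonedges_eq_countStates hB L _ rfl fun u v huv hadj => ?_
  have h : Nat.beq (indepSum digitBase (armTree L) {u, v}) 0 = false :=
    Bool.eq_false_iff.2 fun h =>
      hadj ((indepSum_pair_eq_zero_iff hB _ huv).1 (Nat.eq_of_beq_eq_true h))
  rw [indepSum_addEdge_armTree _ _ huv, h, Bool.not_false, Bool.true_and]

theorem numEnlargements_armTree (L : Fin 3 → List ℕ) :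
    numEnlargements (armTree L) = countEnlargements (fun _ => true) L := by
  rw [← ncard_enlargements, numEnlargements]
  simp

theorem numLogConcaveEnlargements_armTree {L : Fin 3 → List ℕ} (hL : armCard L < 64) :
    numLogConcaveEnlargements (armTree L) = countEnlargements logConcaveList L := by
  rw [← ncard_enlargements, numLogConcaveEnlargements]
  simp only [isLogConcavePoly_iff_decodePoly hL]

/-- Unimodality of all enlargements is reduced to a vanishing count of violations, so the same
merged list of states decides it. -/
theorem isUnimodalPoly_enlargement {L : Fin 3 → List ℕ} (hL : armCard L < 64)
    (h : countEnlargements (fun l => !unimodalList l) L = 0) {e : Sym2 (ArmVertex L)}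
    (he : e ∈ nonedges (armTree L)) : IsUnimodalPoly (indepPoly (addEdge (armTree L) e)) := by
  refine isUnimodalPoly_of_decodePoly hL _ ?_
  rw [← ncard_enlargements, Set.ncard_eq_zero (Set.toFinite _), Set.eq_empty_iff_forall_notMem] at h
  simpa [he] using h e

/-! ### The tested collections -/

theorem testedCollection_armCard : ∀ c, ∀ L ∈ testedCollection c, armCard L < 64 := by
  decide +kernel

theorem testedCollection_not_logConcave : ∀ c, ∀ L ∈ testedCollection c,
    logConcaveList (decodePoly (armValue digitBase L)) = false := by
  decide +kernel

theorem testedCollection_unimodal : ∀ c, ∀ L ∈ testedCollection c,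
    countEnlargements (fun l => !unimodalList l) L = 0 := by
  decide +kernel

theorem testedCollection_countEnlargements : ∀ c, ∑ L ∈ testedCollection c,
    countEnlargements (fun _ => true) L = ![7860, 4136, 4586, 3710, 4136, 4136, 5558] c := by
  decide +kernel

theorem testedCollection_countLogConcave : ∀ c, ∑ L ∈ testedCollection c,
    countEnlargements logConcaveList L = ![2296, 1306, 1822, 1216, 1394, 1211, 3180] c := by
  decide +kernel

theorem sum_numEnlargements (c : Fin 7) :
    ∑ L ∈ testedCollection c, numEnlargements (armTree L) =
      ![7860, 4136, 4586, 3710, 4136, 4136, 5558] c := by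
  simp only [numEnlargements_armTree, testedCollection_countEnlargements]

theorem sum_numLogConcaveEnlargements (c : Fin 7) :
    ∑ L ∈ testedCollection c, numLogConcaveEnlargements (armTree L) =
      ![2296, 1306, 1822, 1216, 1394, 1211, 3180] c := by
  rw [← testedCollection_countLogConcave]
  exact Finset.sum_congr rfl fun L hL =>
    numLogConcaveEnlargements_armTree (testedCollection_armCard c L hL)

theorem not_isLogConcavePoly_testedCollection {c : Fin 7} {L : Fin 3 → List ℕ}
    (hL : L ∈ testedCollection c) : ¬ IsLogConcavePoly (indepPoly (armTree L)) := by
  rw [isLogConcavePoly_iff_decodePoly (testedCollection_armCard c L hL), indepSum_armTree_empty,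
    testedCollection_not_logConcave c L hL]
  exact Bool.false_ne_true

theorem exists_logConcave_enlargement (c : Fin 7) :
    ∃ L ∈ testedCollection c, ∃ e ∈ nonedges (armTree L),
      IsLogConcavePoly (indepPoly (addEdge (armTree L) e)) := by
  -- The witness is not explicit: each of the seven totals is nonzero, so some tree has a
  -- log-concave enlargement. Any such tree serves, since every tested tree is itself not
  -- log-concave.
  have h : ∑ L ∈ testedCollection c, numLogConcaveEnlargements (armTree L) ≠ 0 := by
    rw [sum_numLogConcaveEnlargements]
    revert c
    decide
  obtain ⟨L, hL, h⟩ := Finset.exists_ne_zero_of_sum_ne_zero h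
  obtain ⟨e, he⟩ := Set.nonempty_of_ncard_ne_zero h
  exact ⟨L, hL, e, he⟩

theorem mainTheorem9 :
    -- every enlargement of every tested tree has a unimodal independence polynomial
    (∀ c, ∀ L ∈ testedCollection c, ∀ e ∈ nonedges (armTree L),
      IsUnimodalPoly (indepPoly (addEdge (armTree L) e))) ∧
    -- in every collection non-log-concavity is lost for some enlargement of some tree
    (∀ c, ∃ L ∈ testedCollection c, ¬ IsLogConcavePoly (indepPoly (armTree L)) ∧
      ∃ e ∈ nonedges (armTree L), IsLogConcavePoly (indepPoly (addEdge (armTree L) e))) ∧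
    -- number of enlargements, and of log-concave ones, in each collection
    (∀ c, ∑ L ∈ testedCollection c, numEnlargements (armTree L) =
      ![7860, 4136, 4586, 3710, 4136, 4136, 5558] c) ∧
    (∀ c, ∑ L ∈ testedCollection c, numLogConcaveEnlargements (armTree L) =
      ![2296, 1306, 1822, 1216, 1394, 1211, 3180] c) ∧
    -- totals
    ∑ c, ∑ L ∈ testedCollection c, numEnlargements (armTree L) = 34122 ∧
    ∑ c, ∑ L ∈ testedCollection c, numLogConcaveEnlargements (armTree L) = 12425 := by
  refine ⟨fun c L hL e he => ?_, fun c => ?_, sum_numEnlargements, sum_numLogConcaveEnlargements,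
    ?_, ?_⟩
  · exact isUnimodalPoly_enlargement (testedCollection_armCard c L hL)
      (testedCollection_unimodal c L hL) he
  · obtain ⟨L, hL, h⟩ := exists_logConcave_enlargement c
    exact ⟨L, hL, not_isLogConcavePoly_testedCollection hL, h⟩
  · simp only [sum_numEnlargements]
    rfl
  · simp only [sum_numLogConcaveEnlargements]
    rfl
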